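/- A partial word over an alphabet $A$ is a finite sequence of characters from $A\cup\{\diamond\}$, where $\diamond\notin A$ is the hole character; its hole density is its number of holes divided by its (positive) length. Two partial words $u,v$ of equal length are compatible if $u_i=v_i$ whenever $u_i$ and $v_i$ are both letters. A partial word $w$ over $A$ encounters a pattern $p$ (a word over an alphabet $\mathcal V$) if some factor of $w$ is compatible with $\varphi(p)$ for some nonerasing morphism $\varphi:\mathcal V^*\to A^*$; otherwise $w$ avoids $p$. For a rational $d\in(0,1)$ and an integer $m\ge 1$, let $L_d(m,p)$ be the least $n$ such that there are partial words of length $n$ with hole density $d$ over an $m$-letter alphabet and all of them encounter $p$ ($L_d(m,p)=\infty$ if there is no such $n$). For $k\ge 1$ put $$Q(k)=[1+d(m-1)]^{k}-\left(1-\tfrac1m\right)(md)^{k}.$$ (1) Let $p$ be a pattern with $r$ distinct variables, the $j$th of which occurs $k_j\ge 1$ times, ordered so that $1=k_1=\cdots=k_s<k_{s+1}\le\cdots\le k_r$. Let $n\ge 1$ be an integer such that $dn$ is an integer. If $$n<\left[(s+1)!\prod_{j=s+1}^r\left(\frac{m^{k_j-1}}{Q(k_j)}-1\right)\right]^{\frac1{s+1}},$$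 then there is a partial word of length $n$ with hole density $d$ over an $m$-letter alphabet that avoids $p$. (2) For the Zimin patterns $Z_1=a_1$, $Z_i=Z_{i-1}a_iZ_{i-1}$ and every $i\ge 1$, $$L_d(m,Z_i)\ \ge\ \sqrt{2\prod_{j=1}^{i-1}\left(\frac{m^{2^j-1}}{Q(2^j)}-1\right)}.$$ Both bounds hold exactly, for all $m$, $d$, $p$, $n$ and $i$ as above; in particular they hold with an additional factor $1+o(1)$ on the right-hand side (the error term may be taken to be $0$). -/

import Mathlib

noncomputable section

/-- A partial word over the alphabet `A`: a finite sequence of characters from `A + {hole}`,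
where `none` is the hole character. -/
abbrev PartialWord (A : Type*) := List (Option A)

namespace PartialWord

/-- The number of holes divided by the length. (A partial word of length `0` has no hole density;
the value is then `0` by convention, while only densities `d > 0` are considered below.) -/
def holeDensity {A : Type*} (w : PartialWord A) : ℚ :=
  (w.countP fun c => c.isNone : ℚ) / (w.length : ℚ)

/-- `u ↑ v`: equal lengths, and `u_i = v_i` whenever `u_i` and `v_i` are both letters. -/
def Compatible {A : Type*} (u v : PartialWord A) : Prop :=
  List.Forall₂ (fun a b => ∀ x ∈ a, ∀ y ∈ b, x = y) u v

/-- `w` encounters the pattern `p`: some factor `f` of `w` is compatible with `φ(p)` for some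
nonerasing morphism `φ : V* → A*`. A morphism of free monoids is given by the images of the
letters, `p.flatMap φ` is the image of `p`, and `φ` is nonerasing when no letter has an empty
image. -/
def Encounters {A V : Type*} (w : PartialWord A) (p : List V) : Prop :=
  ∃ φ : V → List A, (∀ v, φ v ≠ []) ∧
    ∃ f : PartialWord A, f <:+: w ∧ Compatible f ((p.flatMap φ).map some)

def Avoids {A V : Type*} (w : PartialWord A) (p : List V) : Prop :=
  ¬ Encounters w p

end PartialWord

/-- `L_d(m, p)`: the least `n` such that there are partial words of length `n` with hole density
`d` over `m` letters and all of them encounter `p` (`⊤` if there is no such `n`). -/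
def partialRamseyLength {V : Type*} (d : ℚ) (m : ℕ) (p : List V) : ℕ∞ :=
  sInf {N : ℕ∞ | ∃ n : ℕ, N = n ∧
    (∃ w : PartialWord (Fin m), w.length = n ∧ w.holeDensity = d) ∧
    ∀ w : PartialWord (Fin m), w.length = n → w.holeDensity = d → w.Encounters p}

/-- The Zimin patterns `Z_1 = a_1`, `Z_{i+1} = Z_i a_{i+1} Z_i` (with `Z_0` empty); the variable
`a_i` is the natural number `i`. -/
def zimin : ℕ → List ℕ
  | 0 => []
  | i + 1 => zimin i ++ [i + 1] ++ zimin i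

/-- `Q = [1 + d(m-1)]^k - (1 - 1/m)(md)^k`. -/
def patternQ (m : ℕ) (d : ℚ) (k : ℕ) : ℝ :=
  (1 + (d : ℝ) * ((m : ℝ) - 1)) ^ k - (1 - 1 / (m : ℝ)) * ((m : ℝ) * (d : ℝ)) ^ k

/-- `s`: the number of variables that occur exactly once in `p`. -/
def numSingle {V : Type*} [DecidableEq V] (p : List V) : ℕ :=
  (p.toFinset.filter fun v => p.count v = 1).card

/-- `[(s+1)! ∏ (m^(k_v - 1) / Q_v - 1)]^(1/(s+1))`, the product being over the variables `v` of `p`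
that occur `k_v ≥ 2` times. -/
def avoidThreshold {V : Type*} [DecidableEq V] (m : ℕ) (d : ℚ) (p : List V) : ℝ :=
  (((numSingle p + 1).factorial : ℝ) *
    ∏ v ∈ p.toFinset.filter (fun v => 2 ≤ p.count v),
      ((m : ℝ) ^ (p.count v - 1) / patternQ m d (p.count v) - 1)) ^
    (1 / ((numSingle p : ℝ) + 1))

end

/-!
Draw a partial word of length `n` with `h = dn` holes uniformly at random and apply the union bound
to the occurrences of `p`, indexed by their starting position and the lengths of the images of the
variables. If the characters were independent, holes with probability `d` and uniform letters
otherwise, then the characters matched with one letter of the image of a variable occurring `k`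
times would be compatible with probability `Q(k) / m ^ (k - 1)`.

The exact bound, without an error term, rests on two estimates. First, the number of holes being
fixed makes the event that `L ≥ 1` given positions carry given characters at most `n / (n + 1 - L)`
times as likely as under independence: one of the `L` draws without replacement costs nothing
extra. Second, when the images of the repeated variables occupy `L` positions, there are at most
`C(n + 1 - L, s + 1)` choices for the starting position and the lengths of the images of the `s`
single variables, and `C(n + 1 - L, s + 1) * n / (n + 1 - L) ≤ n ^ (s + 1) / (s + 1)!` absorbs that
loss. What remains is a sum over the lengths of the images of the repeated variables, which is a
product of geometric series.
-/

open Finset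

section Counting

open scoped Nat

theorem descFactorial_succ_mul_descFactorial_mul_pow_le {h g j i L : ℕ}
    (hlt : L * h ≤ j * (h + g))
    (ih : h.descFactorial j * g.descFactorial i * (h + g) ^ L ≤
      (h + g).descFactorial L * (h ^ j * g ^ i)) :
    h.descFactorial (j + 1) * g.descFactorial i * (h + g) ^ (L + 1) ≤
      (h + g).descFactorial (L + 1) * (h ^ (j + 1) * g ^ i) := by
  have hratio : (h - j) * (h + g) ≤ (h + g - L) * h := by
    rw [Nat.sub_mul, Nat.sub_mul, mul_comm h (h + g)]
    exact Nat.sub_le_sub_left hlt _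
  calc h.descFactorial (j + 1) * g.descFactorial i * (h + g) ^ (L + 1)
    _ = (h.descFactorial j * g.descFactorial i * (h + g) ^ L) * ((h - j) * (h + g)) := by
      rw [Nat.descFactorial_succ]; ring
    _ ≤ ((h + g).descFactorial L * (h ^ j * g ^ i)) * ((h + g - L) * h) :=
      Nat.mul_le_mul ih hratio
    _ = (h + g).descFactorial (L + 1) * (h ^ (j + 1) * g ^ i) := by
      rw [Nat.descFactorial_succ]; ring

theorem descFactorial_mul_descFactorial_mul_pow_le (h g : ℕ) {L j i : ℕ} (hji : j + i = L + 1) :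
    h.descFactorial j * g.descFactorial i * (h + g) ^ L ≤
      (h + g).descFactorial L * (h ^ j * g ^ i) := by
  induction L generalizing j i with
  | zero =>
    obtain ⟨rfl, rfl⟩ | ⟨rfl, rfl⟩ : j = 0 ∧ i = 1 ∨ j = 1 ∧ i = 0 := by omega
    all_goals simp
  | succ L ih =>
    have removeHole {j' : ℕ} (hj : j = j' + 1) (hlt : (L + 0) * h ≤ j' * (h + g)) :
        h.descFactorial j * g.descFactorial i * (h + g) ^ (L + 1) ≤
          (h + g).descFactorial (L + 1) * (h ^ j * g ^ i) := by
      subst hj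
      exact descFactorial_succ_mul_descFactorial_mul_pow_le hlt (ih (by omega))
    have removeLetter {i' : ℕ} (hi : i = i' + 1) (hlt : L * g ≤ i' * (h + g)) :
        h.descFactorial j * g.descFactorial i * (h + g) ^ (L + 1) ≤
          (h + g).descFactorial (L + 1) * (h ^ j * g ^ i) := by
      subst hi
      have := ih (show j + i' = L + 1 by omega)
      rw [add_comm h g] at hlt this ⊢
      rw [mul_comm (h.descFactorial j), mul_comm (h ^ j)] at this ⊢
      exact descFactorial_succ_mul_descFactorial_mul_pow_le hlt this
    rcases j with _ | j'
    · exact removeLetter (show i = L + 1 + 1 by omega) (by gcongr <;> omega)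
    · rcases i with _ | i'
      · exact removeHole rfl (by gcongr <;> omega)
      · have hsum : j' + i' = L := by omega
        rcases le_total (L * h) (j' * (h + g)) with hlt | hlt
        · exact removeHole rfl hlt
        · refine removeLetter rfl ?_
          subst hsum
          nlinarith

theorem choose_mul_descFactorial_mul {h g j i : ℕ} (hj : j ≤ h) (hi : i ≤ g) :
    (h + g).choose h * (h.descFactorial j * g.descFactorial i) =
      (h + g - (j + i)).choose (h - j) * (h + g).descFactorial (j + i) := by
  obtain ⟨a, rfl⟩ := Nat.exists_eq_add_of_le hj
  obtain ⟨b, rfl⟩ := Nat.exists_eq_add_of_le hi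
  have hrest : j + a + (i + b) - (j + i) = a + b := by omega
  have hh := Nat.factorial_mul_descFactorial (Nat.le_add_right j a)
  have hg := Nat.factorial_mul_descFactorial (Nat.le_add_right i b)
  have hn := Nat.factorial_mul_descFactorial (show j + i ≤ j + a + (i + b) by omega)
  have hchoose := Nat.add_choose_mul_factorial_mul_factorial (j + a) (i + b)
  have hchoose_rest := Nat.add_choose_mul_factorial_mul_factorial a b
  rw [← Nat.choose_symm_add] at hchoose hchoose_rest
  rw [Nat.add_sub_cancel_left] at hh hg ⊢
  rw [hrest] at hn ⊢
  apply Nat.eq_of_mul_eq_mul_right (Nat.mul_pos a.factorial_pos b.factorial_pos)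
  calc _ = (j + a + (i + b)).choose (j + a) * (a ! * (j + a).descFactorial j) *
        (b ! * (i + b).descFactorial i) := by ring
    _ = (a + b)! * (j + a + (i + b)).descFactorial (j + i) := by rw [hh, hg, hchoose, hn]
    _ = _ := by rw [← hchoose_rest]; ring

theorem choose_succ_mul_factorial_le {M n : ℕ} (hM : M ≤ n + 1) (s : ℕ) :
    M.choose (s + 1) * (s + 1)! ≤ n ^ s * M := by
  rcases M with _ | M
  · simp
  · rw [mul_comm, ← Nat.descFactorial_eq_factorial_mul_choose, Nat.succ_descFactorial_succ,
      mul_comm]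
    have : M.descFactorial s ≤ n ^ s :=
      (M.descFactorial_le_pow s).trans (Nat.pow_le_pow_left (by omega) s)
    gcongr

theorem factorial_succ_le_self_pow {n : ℕ} (hn : 2 ≤ n) : (n + 1)! ≤ n ^ (n + 1) := by
  induction n, hn using Nat.le_induction with
  | base => decide
  | succ n _ ih =>
    calc (n + 1 + 1)! = (n + 2) * (n + 1)! := Nat.factorial_succ _
      _ ≤ (n + 2) * n ^ (n + 1) := by gcongr
      _ = ((n + 2) * n) * n ^ n := by ring
      _ ≤ (n + 1) ^ 2 * (n + 1) ^ n := by gcongr <;> nlinarith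
      _ = (n + 1) ^ (n + 1 + 1) := by ring

theorem factorial_succ_le_pow {s n : ℕ} (hs : s ≤ n) (hn : 2 ≤ n) : (s + 1)! ≤ n ^ (s + 1) := by
  rcases hs.eq_or_lt with rfl | hlt
  · exact factorial_succ_le_self_pow hn
  · exact (Nat.factorial_le_pow (s + 1)).trans (Nat.pow_le_pow_left hlt _)

theorem card_le_choose_of_sum_le {ι : Type*} [Fintype ι] {M : ℕ} {P : Finset (ι → ℕ)}
    (hP : ∀ g ∈ P, (∀ i, 1 ≤ g i) ∧ ∑ i, g i ≤ M) : #P ≤ M.choose (Fintype.card ι) := by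
  classical
  have sum_sub_one {g : ι → ℕ} (hg : g ∈ P) :
      ∑ i, (g i - 1) = ∑ i, g i - Fintype.card ι ∧ Fintype.card ι ≤ ∑ i, g i := by
    have := sum_tsub_distrib univ fun i _ => (hP g hg).1 i
    have := sum_le_sum fun i (_ : i ∈ univ) => (hP g hg).1 i
    simp_all
  -- Stars and bars: `g` is determined by the numbers `g i - 1` and the slack `M - ∑ g`.
  let slack (g : ι → ℕ) : Option ι →₀ ℕ :=
    Finsupp.equivFunOnFinite.symm fun o => o.elim (M - ∑ i, g i) fun i => g i - 1
  have hmaps : ∀ g ∈ P, slack g ∈ univ.finsuppAntidiag (M - Fintype.card ι) := fun g hg => by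
    have := sum_sub_one hg
    have := (hP g hg).2
    simp only [mem_finsuppAntidiag, subset_univ, and_true, slack, Fintype.sum_option,
      Finsupp.equivFunOnFinite_symm_apply_apply, Option.elim]
    omega
  have hinj : Set.InjOn slack P := fun g hg g' hg' h => funext fun i => by
    have hi := DFunLike.congr_fun h (some i)
    have := (hP g hg).1 i
    have := (hP g' hg').1 i
    simp only [slack, Finsupp.equivFunOnFinite_symm_apply_apply, Option.elim] at hi
    omega
  rcases P.eq_empty_or_nonempty with rfl | ⟨g, hg⟩
  · simp
  · have hle : Fintype.card ι ≤ M := (sum_sub_one hg).2.trans (hP g hg).2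
    calc #P ≤ #(univ.finsuppAntidiag (ι := Option ι) (M - Fintype.card ι)) :=
          card_le_card_of_injOn slack hmaps hinj
      _ = M.choose (Fintype.card ι) := by
        rw [card_finsuppAntidiag_nat_eq_choose, card_univ, Fintype.card_option,
          ← Nat.choose_symm hle]
        congr 1
        omega

end Counting

namespace PartialWord

section CharWeight

variable {A : Type*} [Fintype A]

/-- The probability of a single character when holes have probability `d` and all letters are
equally likely. -/
noncomputable def charWeight (d : ℝ) : Option A → ℝ
  | none => d
  | some _ => (1 - d) / Fintype.card A

theorem charWeight_nonneg {d : ℝ} (hd0 : 0 ≤ d) (hd1 : d ≤ 1) (c : Option A) :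
    0 ≤ charWeight d c := by
  have : 0 ≤ 1 - d := sub_nonneg.2 hd1
  cases c <;> simp only [charWeight] <;> positivity

theorem sum_charWeight [Nonempty A] (d : ℝ) : ∑ c : Option A, charWeight d c = 1 := by
  have : (Fintype.card A : ℝ) ≠ 0 := by simp
  simp only [Fintype.sum_option, charWeight, sum_const, card_univ, nsmul_eq_mul]
  field_simp
  ring

theorem prod_charWeight (d : ℝ) {T : Type*} (S : Finset T) (u : T → Option A) :
    ∏ t ∈ S, charWeight d (u t) =
      d ^ #{t ∈ S | u t = none} * ((1 - d) / Fintype.card A) ^ #{t ∈ S | u t ≠ none} := by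
  rw [← prod_filter_mul_prod_filter_not S fun t => u t = none]
  congr 1 <;> refine prod_eq_pow_card fun t ht => ?_
  · rw [(mem_filter.1 ht).2, charWeight]
  · obtain ⟨a, ha⟩ := Option.ne_none_iff_exists'.1 (mem_filter.1 ht).2
    rw [ha, charWeight]

end CharWeight

section Counting

variable {T A : Type*} [Fintype T] [DecidableEq T] [Fintype A]

variable (T A) in
/-- The partial words over `A` with exactly `h` holes. Positions are indexed by a type `T` instead
of `Fin n`, so that words of a fixed length are functions. -/
def wordsWithHoles (h : ℕ) : Finset (T → Option A) :=
  {w | #{t | w t = none} = h}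

theorem mem_wordsWithHoles {h : ℕ} {w : T → Option A} :
    w ∈ wordsWithHoles T A h ↔ #{t | w t = none} = h := by
  simp [wordsWithHoles]

open Polynomial in
theorem card_wordsWithHoles_prescribed_eq_coeff [DecidableEq A] (h : ℕ) (S : Finset T)
    (u : T → Option A) :
    #{w ∈ wordsWithHoles T A h | ∀ t ∈ S, w t = u t} =
      ((X : ℕ[X]) ^ #{t ∈ S | u t = none} *
        (X + C (Fintype.card A)) ^ (Fintype.card T - #S)).coeff h := by
  let marker (c : Option A) : ℕ[X] := if c = none then X else 1
  let choices (t : T) : Finset (Option A) := if t ∈ S then {u t} else univ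
  have hmarker (w : T → Option A) (R : Finset T) :
      ∏ t ∈ R, marker (w t) = X ^ #{t ∈ R | w t = none} := by
    rw [prod_ite, prod_const, prod_const_one, mul_one]
  have hprod : ∏ t, ∑ c ∈ choices t, marker c =
      X ^ #{t ∈ S | u t = none} * (X + C (Fintype.card A)) ^ (Fintype.card T - #S) := by
    rw [← prod_mul_prod_compl S, ← hmarker, ← card_compl, ← prod_const]
    congr 1 <;> refine prod_congr rfl fun t ht => ?_
    · simp [choices, ht]
    · simp [choices, marker, mem_compl.1 ht, Fintype.sum_option]
  have hwords : ({w ∈ wordsWithHoles T A h | ∀ t ∈ S, w t = u t} : Finset _) =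
      {w ∈ Fintype.piFinset choices | h = #{t | w t = none}} := by
    ext w
    have hchoices : w ∈ Fintype.piFinset choices ↔ ∀ t ∈ S, w t = u t := by
      refine Fintype.mem_piFinset.trans (forall_congr' fun t => ?_)
      by_cases ht : t ∈ S <;> simp [choices, ht]
    rw [mem_filter, mem_filter, mem_wordsWithHoles, hchoices, and_comm, eq_comm]
  rw [hwords, ← hprod, prod_univ_sum, finsetSum_coeff]
  simp_rw [hmarker, coeff_X_pow]
  rw [sum_boole, Nat.cast_id]

theorem card_wordsWithHoles (h : ℕ) :
    #(wordsWithHoles T A h) =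
      Fintype.card A ^ (Fintype.card T - h) * (Fintype.card T).choose h := by
  classical
  have := card_wordsWithHoles_prescribed_eq_coeff (T := T) (A := A) h ∅ fun _ => none
  rw [Polynomial.coeff_X_pow_mul', Polynomial.coeff_X_add_C_pow] at this
  simpa using this

theorem card_prescribed_mul_descFactorial [DecidableEq A] {h g : ℕ}
    (hT : Fintype.card T = h + g) (S : Finset T) (u : T → Option A) :
    #{w ∈ wordsWithHoles T A h | ∀ t ∈ S, w t = u t} *
        ((h + g).descFactorial #S * Fintype.card A ^ #{t ∈ S | u t ≠ none}) =
      #(wordsWithHoles T A h) *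
        (h.descFactorial #{t ∈ S | u t = none} * g.descFactorial #{t ∈ S | u t ≠ none}) := by
  have hji := S.card_filter_add_card_filter_not fun t => u t = none
  have hSn : #S ≤ h + g := hT ▸ card_le_univ S
  rw [card_wordsWithHoles_prescribed_eq_coeff, Polynomial.coeff_X_pow_mul', card_wordsWithHoles,
    hT, Nat.add_sub_cancel_left]
  simp only [ne_eq]
  set j := #{t ∈ S | u t = none}
  set i := #{t ∈ S | ¬u t = none}
  rcases lt_or_ge h j with hj | hj
  · rw [if_neg (by omega), Nat.descFactorial_of_lt hj]
    simp
  rw [if_pos hj, Polynomial.coeff_X_add_C_pow, Nat.cast_id]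
  rcases lt_or_ge g i with hi | hi
  · rw [Nat.choose_eq_zero_of_lt (by omega), Nat.descFactorial_of_lt hi]
    simp
  have hletters : h + g - #S - (h - j) + i = g := by omega
  rw [← hji] at hletters ⊢
  calc _ = Fintype.card A ^ (h + g - (j + i) - (h - j) + i) *
        ((h + g - (j + i)).choose (h - j) * (h + g).descFactorial (j + i)) := by ring
    _ = _ := by rw [← choose_mul_descFactorial_mul hj hi, hletters, mul_assoc]

theorem card_prescribed_mul_le [DecidableEq A] {h g L : ℕ} (hT : Fintype.card T = h + g)
    {S : Finset T} (hS : #S = L + 1) (u : T → Option A) :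
    #{w ∈ wordsWithHoles T A h | ∀ t ∈ S, w t = u t} * (h + g - L) *
        (Fintype.card A ^ #{t ∈ S | u t ≠ none} * (h + g) ^ L) ≤
      #(wordsWithHoles T A h) * (h ^ #{t ∈ S | u t = none} * g ^ #{t ∈ S | u t ≠ none}) := by
  have hji := (S.card_filter_add_card_filter_not fun t => u t = none).trans hS
  have hcount := card_prescribed_mul_descFactorial hT S u
  have hdraws := descFactorial_mul_descFactorial_mul_pow_le h g hji
  have hSn : #S ≤ h + g := hT ▸ card_le_univ S
  rw [hS, Nat.descFactorial_succ] at hcount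
  refine Nat.le_of_mul_le_mul_left ?_ (Nat.descFactorial_pos.2 (show L ≤ h + g by omega))
  set N := #{w ∈ wordsWithHoles T A h | ∀ t ∈ S, w t = u t}
  set W := #(wordsWithHoles T A h)
  set j := #{t ∈ S | u t = none}
  set i := #{t ∈ S | u t ≠ none}
  calc (h + g).descFactorial L * (N * (h + g - L) * (Fintype.card A ^ i * (h + g) ^ L))
    _ = N * ((h + g - L) * (h + g).descFactorial L * Fintype.card A ^ i) * (h + g) ^ L := by
      ring
    _ = W * (h.descFactorial j * g.descFactorial i * (h + g) ^ L) := by rw [hcount]; ring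
    _ ≤ W * ((h + g).descFactorial L * (h ^ j * g ^ i)) := by gcongr
    _ = (h + g).descFactorial L * (W * (h ^ j * g ^ i)) := by ring

theorem card_prescribed_mul_le_prod_charWeight [DecidableEq A] [Nonempty A] {h : ℕ}
    (hT : h ≤ Fintype.card T) {S : Finset T} (hS : S.Nonempty) (u : T → Option A) :
    (#{w ∈ wordsWithHoles T A h | ∀ t ∈ S, w t = u t} : ℝ) * (Fintype.card T + 1 - #S) ≤
      #(wordsWithHoles T A h) * Fintype.card T *
        ∏ t ∈ S, charWeight ((h : ℝ) / Fintype.card T) (u t) := by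
  obtain ⟨g, hg⟩ := Nat.exists_eq_add_of_le hT
  obtain ⟨L, hL⟩ := Nat.exists_eq_succ_of_ne_zero hS.card_ne_zero
  have hji := (S.card_filter_add_card_filter_not fun t => u t = none).trans hL
  have hSn : #S ≤ Fintype.card T := card_le_univ S
  have hpos : (0 : ℝ) < h + g := by exact_mod_cast (by omega : 0 < h + g)
  have : (0 : ℝ) < Fintype.card A := by exact_mod_cast Fintype.card_pos
  have key : ((_ : ℕ) : ℝ) ≤ ((_ : ℕ) : ℝ) := Nat.cast_le.2 (card_prescribed_mul_le hg hL u)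
  rw [prod_charWeight, hg, hL]
  push_cast [show L ≤ h + g by omega] at key ⊢
  simp only [ne_eq] at key ⊢
  set N := #{w ∈ wordsWithHoles T A h | ∀ t ∈ S, w t = u t}
  set W := #(wordsWithHoles T A h)
  set j := #{t ∈ S | u t = none}
  set i := #{t ∈ S | ¬u t = none}
  have hpow : (h + g : ℝ) * (h + g) ^ L = (h + g) ^ j * (h + g) ^ i := by
    rw [← pow_add, hji, pow_succ']
  have hweight : (1 - (h : ℝ) / (h + g)) / Fintype.card A = g / ((h + g) * Fintype.card A) := by
    field_simp
    ring
  refine le_of_mul_le_mul_right ?_ (show (0 : ℝ) < Fintype.card A ^ i * (h + g) ^ L by positivity)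
  calc _ = N * ((h + g : ℝ) - L) * (Fintype.card A ^ i * (h + g) ^ L) := by ring
    _ ≤ W * (h ^ j * g ^ i) := key
    _ = W * (h ^ j * g ^ i) * (Fintype.card A ^ i / Fintype.card A ^ i) *
        ((h + g : ℝ) * (h + g) ^ L / ((h + g) ^ j * (h + g) ^ i)) := by
      rw [hpow, div_self (by positivity), div_self (by positivity)]; ring
    _ = _ := by rw [hweight, div_pow, div_pow, mul_pow]; ring

theorem card_comp_mul_le {ι : Type*} [Fintype ι] [Nonempty ι] [DecidableEq ι] [Nonempty A] {h : ℕ}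
    (hT : h ≤ Fintype.card T) (e : ι ↪ T) (E : (ι → Option A) → Prop) [DecidablePred E] :
    (#{w ∈ wordsWithHoles T A h | E (w ∘ e)} : ℝ) * (Fintype.card T + 1 - Fintype.card ι) ≤
      #(wordsWithHoles T A h) * Fintype.card T *
        ∑ u with E u, ∏ i, charWeight ((h : ℝ) / Fintype.card T) (u i) := by
  classical
  have hι : (Fintype.card ι : ℝ) ≤ Fintype.card T := by
    exact_mod_cast Fintype.card_le_of_embedding e
  rw [card_eq_sum_card_fiberwise (f := (· ∘ e)) (t := ({u | E u} : Finset (ι → Option A)))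
    (fun w hw => by simpa using (mem_filter.1 hw).2), Nat.cast_sum, sum_mul, mul_sum]
  refine sum_le_sum fun u _ => ?_
  have key := card_prescribed_mul_le_prod_charWeight hT (univ_nonempty.map (f := e))
    (Function.extend e u fun _ => none)
  simp only [prod_map, card_map, card_univ, e.injective.extend_apply] at key
  refine (mul_le_mul_of_nonneg_right (Nat.cast_le.2 (card_le_card fun w hw => ?_)) ?_).trans key
  · simp only [mem_filter] at hw
    refine mem_filter.2 ⟨hw.1.1, fun t ht => ?_⟩
    obtain ⟨i, -, rfl⟩ := mem_map.1 ht
    rw [e.injective.extend_apply, ← hw.2, Function.comp_apply]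
  · linarith

end Counting

section ConstUpToHoles

/-- A family of characters is constant up to holes: its letters all agree. Over a nonempty alphabet
this is what an occurrence of a pattern demands of the characters matched with a single letter of
the image of a variable. -/
def ConstUpToHoles {F A : Type*} (v : F → Option A) : Prop :=
  ∃ a, ∀ i, v i = none ∨ v i = some a

noncomputable instance {F A : Type*} : DecidablePred (ConstUpToHoles (F := F) (A := A)) :=
  Classical.decPred _

/-- The probability that `k` independent characters, each of them a hole with probability `d` and
otherwise one of `m` equally likely letters, are constant up to holes. -/
noncomputable def constProb (m : ℕ) (d : ℝ) (k : ℕ) : ℝ :=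
  d ^ k + m * ((d + (1 - d) / m) ^ k - d ^ k)

variable {A : Type*} [Fintype A]

theorem sum_constUpToHoles [Nonempty A] {F : Type*} [Fintype F] [DecidableEq F] (d : ℝ) :
    ∑ v : F → Option A with ConstUpToHoles v, ∏ i, charWeight d (v i) =
      constProb (Fintype.card A) d (Fintype.card F) := by
  classical
  let holes : F → Option A := fun _ => none
  let withLetter (a : A) : Finset (F → Option A) := Fintype.piFinset fun _ => {none, some a}
  have holes_mem (a : A) : holes ∈ withLetter a := by simp [withLetter, holes]
  have hfilter : ({v | ConstUpToHoles v} : Finset (F → Option A)) =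
      insert holes (univ.biUnion fun a => (withLetter a).erase holes) := by
    ext v
    obtain ⟨b⟩ := ‹Nonempty A›
    rw [mem_filter_univ, mem_insert, mem_biUnion, ConstUpToHoles]
    by_cases hv : v = holes
    · exact iff_of_true ⟨b, fun i => .inl (congrFun hv i)⟩ (.inl hv)
    · simp [hv, withLetter]
  have hdisj : ((univ : Finset A) : Set A).PairwiseDisjoint
      fun a => (withLetter a).erase holes := by
    refine fun a _ b _ hab => disjoint_left.2 fun v ha hb => ?_
    simp only [withLetter, mem_erase, Fintype.mem_piFinset, mem_insert, mem_singleton] at ha hb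
    refine ha.1 (funext fun i => (ha.2 i).elim id fun hia => (hb.2 i).elim id fun hib => ?_)
    exact absurd (Option.some_injective _ (hia.symm.trans hib)) hab
  have hholes : ∏ i, charWeight d (holes i) = d ^ Fintype.card F := by simp [holes, charWeight]
  have hletter (a : A) : ∑ v ∈ withLetter a, ∏ i, charWeight d (v i) =
      (d + (1 - d) / Fintype.card A) ^ Fintype.card F := by
    rw [← prod_univ_sum (fun _ : F => {none, some a}) fun _ => charWeight d,
      sum_pair (by simp), prod_const, card_univ, charWeight, charWeight]
  rw [hfilter, sum_insert (by simp), sum_biUnion hdisj, hholes, constProb]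
  simp only [sum_erase_eq_sub (holes_mem _), hletter, hholes, sum_const, card_univ, nsmul_eq_mul]

theorem constProb_card_le_one [Nonempty A] {d : ℝ} (hd0 : 0 ≤ d) (hd1 : d ≤ 1) (k : ℕ) :
    constProb (Fintype.card A) d k ≤ 1 :=
  calc constProb (Fintype.card A) d k
    _ = ∑ v : Fin k → Option A with ConstUpToHoles v, ∏ i, charWeight d (v i) := by
      rw [sum_constUpToHoles, Fintype.card_fin]
    _ ≤ ∑ v : Fin k → Option A, ∏ i, charWeight d (v i) :=
      sum_le_sum_of_subset_of_nonneg (filter_subset _ _) fun v _ _ =>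
        prod_nonneg fun i _ => charWeight_nonneg hd0 hd1 (v i)
    _ = ∏ _i : Fin k, ∑ c : Option A, charWeight d c := by
      rw [prod_univ_sum, Fintype.piFinset_univ]
    _ = 1 := by simp only [sum_charWeight, prod_const_one]

theorem pow_le_constProb {d : ℝ} (hd0 : 0 ≤ d) (hd1 : d ≤ 1) (m k : ℕ) :
    d ^ k ≤ constProb m d k := by
  have hd : 0 ≤ (1 - d) / m := div_nonneg (sub_nonneg.2 hd1) m.cast_nonneg
  have : d ^ k ≤ (d + (1 - d) / m) ^ k := pow_le_pow_left₀ hd0 (by linarith) k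
  exact le_add_of_nonneg_right (mul_nonneg m.cast_nonneg (sub_nonneg.2 this))

theorem constProb_nonneg {d : ℝ} (hd0 : 0 ≤ d) (hd1 : d ≤ 1) (m k : ℕ) : 0 ≤ constProb m d k :=
  (pow_nonneg hd0 k).trans (pow_le_constProb hd0 hd1 m k)

theorem constProb_pos {d : ℝ} (hd0 : 0 < d) (hd1 : d ≤ 1) (m k : ℕ) : 0 < constProb m d k :=
  (pow_pos hd0 k).trans_le (pow_le_constProb hd0.le hd1 m k)

theorem pow_div_patternQ_eq_inv_constProb {m : ℕ} (hm : m ≠ 0) (d : ℚ) {k : ℕ} (hk : k ≠ 0) :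
    (m : ℝ) ^ (k - 1) / patternQ m d k = (constProb m d k)⁻¹ := by
  have hm' : (m : ℝ) ≠ 0 := Nat.cast_ne_zero.2 hm
  obtain ⟨k, rfl⟩ := Nat.exists_eq_succ_of_ne_zero hk
  have hbase : (d : ℝ) + (1 - d) / m = (1 + d * (m - 1)) / m := by field_simp; ring
  have : patternQ m d (k + 1) = m ^ k * constProb m d (k + 1) := by
    rw [constProb, hbase, patternQ, div_pow, mul_pow]
    field_simp
    ring
  rw [Nat.succ_eq_add_one, Nat.add_sub_cancel, this, div_mul_cancel_left₀ (pow_ne_zero k hm')]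

end ConstUpToHoles

theorem sum_forall_prod_sigma {C B : Type*} [Fintype C] [DecidableEq C] [Fintype B] {F : C → Type*}
    [∀ c, Fintype (F c)] [∀ c, DecidableEq (F c)] (P : ∀ c, (F c → B) → Prop)
    [∀ c, DecidablePred (P c)] {R : Type*} [CommSemiring R] (f : B → R) :
    ∑ u : (Σ c, F c) → B with ∀ c, P c fun i => u ⟨c, i⟩, ∏ i, f (u i) =
      ∏ c, ∑ v with P c v, ∏ i, f (v i) := by
  rw [prod_univ_sum]
  refine sum_bij' (fun u _ c i => u ⟨c, i⟩) (fun v _ i => v i.1 i.2) ?_ ?_ ?_ ?_ ?_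
  · intro u hu
    simpa using hu
  · intro v hv
    simpa using hv
  · intros; rfl
  · intros; rfl
  · intro u _
    rw [Fintype.prod_sigma]

section Labels

variable {V : Type*}

/-- The letters of the image of `p` under a morphism mapping each `v` to a word of length `ℓ v`:
`⟨v, q⟩` stands for the `q`-th letter of the image of `v`. -/
def labels (p : List V) (ℓ : V → ℕ) : List (Σ v, Fin (ℓ v)) :=
  p.flatMap fun v => (List.finRange (ℓ v)).map (Sigma.mk v)

theorem flatMap_eq_map_labels {A : Type*} (p : List V) (φ : V → List A) :
    p.flatMap φ = (labels p fun v => (φ v).length).map fun c => (φ c.1).get c.2 := by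
  rw [labels, List.map_flatMap]
  refine List.flatMap_congr fun v _ => ?_
  rw [List.map_map]
  exact (List.map_get_finRange _).symm

variable [DecidableEq V]

theorem length_labels [Fintype V] (p : List V) (ℓ : V → ℕ) :
    (labels p ℓ).length = ∑ v, p.count v * ℓ v := by
  simp only [labels, List.length_flatMap, List.length_map, List.length_finRange]
  rw [sum_list_map_count]
  refine sum_subset (subset_univ _) fun v _ hv => ?_
  rw [List.count_eq_zero.2 (mt List.mem_toFinset.2 hv), zero_smul]

theorem count_labels (p : List V) (ℓ : V → ℕ) (c : Σ v, Fin (ℓ v)) :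
    (labels p ℓ).count c = p.count c.1 := by
  obtain ⟨v, q⟩ := c
  induction p with
  | nil => rfl
  | cons x p ih =>
    have hcount : ((List.finRange (ℓ x)).map (Sigma.mk x)).count (⟨v, q⟩ : Σ v, Fin (ℓ v)) =
        if x = v then 1 else 0 := by
      split_ifs with hx
      · subst hx
        rw [List.count_map_of_injective _ _ sigma_mk_injective]
        exact List.count_eq_one_of_mem (List.nodup_finRange _) (List.mem_finRange q)
      · refine List.count_eq_zero.2 fun hmem => hx ?_
        obtain ⟨_, -, h⟩ := List.mem_map.1 hmem
        exact congrArg Sigma.fst h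
    rw [labels, List.flatMap_cons, List.count_append, hcount, List.count_cons, add_comm]
    simp only [beq_iff_eq]
    exact congrArg (· + _) ih

theorem card_labels_get_eq (p : List V) (ℓ : V → ℕ) (c : Σ v, Fin (ℓ v)) :
    Fintype.card {i // (labels p ℓ).get i = c} = p.count c.1 := by
  have := Fin.card_filter_univ_eq_vector_get_eq_count c ⟨labels p ℓ, rfl⟩
  rw [← count_labels p ℓ c, Fintype.card_subtype]
  exact this

end Labels

section EncountersAt

variable {A V : Type*} {n : ℕ}

/-- `w` encounters `p` at position `a`, under a morphism that maps each variable `v` to a word of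
length `ℓ v`. -/
def EncountersAt (p : List V) (a : ℕ) (ℓ : V → ℕ) (w : Fin n → Option A) : Prop :=
  ∃ h : a + (labels p ℓ).length ≤ n, ∀ c,
    ConstUpToHoles fun i : {i // (labels p ℓ).get i = c} => w ((Fin.natAdd a i.1).castLE h)

noncomputable instance (p : List V) (a : ℕ) (ℓ : V → ℕ) :
    DecidablePred (EncountersAt p a ℓ : (Fin n → Option A) → Prop) :=
  Classical.decPred _

theorem Encounters.exists_encountersAt {p : List V} {w : Fin n → Option A}
    (hw : Encounters (List.ofFn w) p) :
    ∃ (a : ℕ) (ℓ : V → ℕ), (∀ v, 1 ≤ ℓ v) ∧ EncountersAt p a ℓ w := by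
  obtain ⟨φ, hφ, f, ⟨pre, post, hfactor⟩, hcompat⟩ := hw
  obtain ⟨ℓ, ψ, hℓ, himage⟩ : ∃ (ℓ : V → ℕ) (ψ : (Σ v, Fin (ℓ v)) → A), (∀ v, 1 ≤ ℓ v) ∧
      p.flatMap φ = (labels p ℓ).map ψ :=
    ⟨_, _, fun v => List.length_pos_iff.2 (hφ v), flatMap_eq_map_labels p φ⟩
  rw [himage, List.map_map] at hcompat
  obtain ⟨hlen, hmatch⟩ := List.forall₂_iff_get.1 hcompat
  rw [List.length_map] at hlen
  have hn : pre.length + f.length + post.length = n := by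
    simpa [add_assoc] using congrArg List.length hfactor
  refine ⟨pre.length, ℓ, hℓ, by omega, fun c => ⟨ψ c, ?_⟩⟩
  rintro ⟨i, rfl⟩
  have hi : i.1 < f.length := i.2.trans_eq hlen.symm
  have hchar : w ((Fin.natAdd pre.length i).castLE (by omega)) = f[i.1] := by
    have hget := congrArg (·[pre.length + i.1]?) hfactor
    simp only [List.append_assoc] at hget
    rw [List.getElem?_append_right (by omega), Nat.add_sub_cancel_left,
      List.getElem?_append_left hi, List.getElem?_eq_getElem hi,
      List.getElem?_eq_getElem (by rw [List.length_ofFn]; omega), List.getElem_ofFn] at hget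
    exact (Option.some_injective _ hget).symm
  have hletter := hmatch i.1 hi (by simp)
  simp only [List.get_eq_getElem, List.getElem_map, Function.comp_apply] at hletter
  dsimp only
  rw [hchar]
  cases hf : f[i.1] with
  | none => exact .inl rfl
  | some x => exact .inr (congrArg some (hletter x hf _ rfl))

theorem card_encountersAt_mul_le [Fintype A] [Nonempty A] [DecidableEq V] {p : List V} {a h : ℕ}
    {ℓ : V → ℕ} (hn : h ≤ n) (hlen : a + (labels p ℓ).length ≤ n) {τ : Finset V}
    (hτ : 0 < ∑ v ∈ τ, p.count v * ℓ v) :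
    (#{w ∈ wordsWithHoles (Fin n) A h | EncountersAt p a ℓ w} : ℝ) *
        (n + 1 - (∑ v ∈ τ, p.count v * ℓ v : ℕ)) ≤
      #(wordsWithHoles (Fin n) A h) * n *
        ∏ v ∈ τ, constProb (Fintype.card A) ((h : ℝ) / n) (p.count v) ^ ℓ v := by
  let positions (c : Σ v : τ, Fin (ℓ v)) : Type := {i // (labels p ℓ).get i = ⟨c.1, c.2⟩}
  have hpositions (c : Σ v : τ, Fin (ℓ v)) : Fintype.card (positions c) = p.count c.1.1 :=
    card_labels_get_eq p ℓ ⟨c.1, c.2⟩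
  let e : (Σ c, positions c) ↪ Fin n := ⟨fun x => (Fin.natAdd a x.2.1).castLE hlen, by
    rintro ⟨⟨v, q⟩, i, hi⟩ ⟨⟨v', q'⟩, i', hi'⟩ hii'
    obtain rfl : i = i' := by simpa [Fin.ext_iff] using hii'
    have := hi.symm.trans hi'
    simp only [Sigma.mk.injEq] at this
    obtain ⟨hv, hq⟩ := this
    obtain rfl := Subtype.ext hv
    obtain rfl := eq_of_heq hq
    rfl⟩
  have hcard : Fintype.card (Σ c, positions c) = ∑ v ∈ τ, p.count v * ℓ v := by
    simp only [Fintype.card_sigma, hpositions, Fintype.sum_sigma, sum_const, card_univ,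
      Fintype.card_fin, smul_eq_mul, mul_comm]
    exact sum_coe_sort τ fun v => ℓ v * p.count v
  have : Nonempty (Σ c, positions c) := Fintype.card_pos_iff.1 (hcard ▸ hτ)
  have hprod : ∑ u : (Σ c, positions c) → Option A with
        ∀ c, ConstUpToHoles fun i => u ⟨c, i⟩, ∏ i, charWeight ((h : ℝ) / n) (u i) =
      ∏ v ∈ τ, constProb (Fintype.card A) ((h : ℝ) / n) (p.count v) ^ ℓ v := by
    rw [sum_forall_prod_sigma fun _ => ConstUpToHoles]
    simp only [sum_constUpToHoles, hpositions, Fintype.prod_sigma, prod_const, card_univ,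
      Fintype.card_fin]
    exact prod_coe_sort τ fun v => constProb (Fintype.card A) ((h : ℝ) / n) (p.count v) ^ ℓ v
  have hLn : ((∑ v ∈ τ, p.count v * ℓ v : ℕ) : ℝ) ≤ n := by
    exact_mod_cast hcard ▸ (Fintype.card_le_of_embedding e).trans_eq (Fintype.card_fin n)
  have key := card_comp_mul_le (A := A) (by simpa using hn) e
    fun u => ∀ c, ConstUpToHoles fun i => u ⟨c, i⟩
  rw [hcard, Fintype.card_fin, hprod] at key
  refine (mul_le_mul_of_nonneg_right (Nat.cast_le.2 (card_le_card ?_)) (by linarith)).trans key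
  exact monotone_filter_right _ fun w _ ⟨_, hw⟩ c => hw _

end EncountersAt

section Occurrences

variable {A V : Type*} [DecidableEq V] {p : List V} {n : ℕ}

theorem le_count_mul_of_mem (hp : ∀ v, v ∈ p) (v : V) (k : ℕ) : k ≤ p.count v * k :=
  Nat.le_mul_of_pos_left k (List.count_pos_iff.2 (hp v))

noncomputable instance (p : List V) :
    DecidablePred fun w : Fin n → Option A => Encounters (List.ofFn w) p :=
  Classical.decPred _

variable [Fintype V]

/-- The possible shapes `(a, ℓ)` of an occurrence of `p` in a word of length `n`: the position `a`
where it starts and the lengths `ℓ v` of the images of the variables. -/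
def occurrences (p : List V) (n : ℕ) : Finset (ℕ × (V → ℕ)) :=
  {o ∈ range (n + 1) ×ˢ Fintype.piFinset fun _ => Icc 1 n | o.1 + ∑ v, p.count v * o.2 v ≤ n}

theorem mem_occurrences (hp : ∀ v, v ∈ p) {a : ℕ} {ℓ : V → ℕ} :
    (a, ℓ) ∈ occurrences p n ↔ (∀ v, 1 ≤ ℓ v) ∧ a + ∑ v, p.count v * ℓ v ≤ n := by
  simp only [occurrences, mem_filter, mem_product, mem_range, Fintype.mem_piFinset, mem_Icc]
  refine ⟨fun ⟨⟨_, hℓ⟩, hle⟩ => ⟨fun v => (hℓ v).1, hle⟩, fun ⟨hℓ, hle⟩ =>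
    ⟨⟨by omega, fun v => ⟨hℓ v, ?_⟩⟩, hle⟩⟩
  have : p.count v * ℓ v ≤ ∑ v, p.count v * ℓ v :=
    single_le_sum (f := fun v => p.count v * ℓ v) (fun _ _ => Nat.zero_le _) (mem_univ v)
  have := le_count_mul_of_mem hp v (ℓ v)
  omega

theorem card_occurrences_restrict_eq_le (hp : ∀ v, v ∈ p) (τ : Finset V) (l : τ → ℕ) :
    #{o ∈ occurrences p n | τ.restrict o.2 = l} ≤
      (n + 1 - ∑ v : τ, p.count v.1 * l v).choose (#τᶜ + 1) := by
  let freeData (o : ℕ × (V → ℕ)) : Option ↥τᶜ → ℕ := fun i => i.elim (o.1 + 1) fun v => o.2 v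
  rw [← Fintype.card_coe τᶜ, ← Fintype.card_option, ← card_image_of_injOn (f := freeData)]
  · refine card_le_choose_of_sum_le ?_
    simp only [forall_mem_image, mem_filter, and_imp, Prod.forall]
    rintro a ℓ ho rfl
    obtain ⟨hℓ, hle⟩ := (mem_occurrences hp).1 ho
    refine ⟨fun i => ?_, ?_⟩
    · cases i with
      | none => exact Nat.le_add_left 1 a
      | some v => exact hℓ v
    · have hfree : ∑ v ∈ τᶜ, ℓ v ≤ ∑ v ∈ τᶜ, p.count v * ℓ v :=
        sum_le_sum fun v _ => le_count_mul_of_mem hp v (ℓ v)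
      have hsplit := sum_add_sum_compl τ fun v => p.count v * ℓ v
      simp only [freeData, Fintype.sum_option, Option.elim, restrict]
      rw [sum_coe_sort τᶜ ℓ, sum_coe_sort τ fun v => p.count v * ℓ v]
      omega
  · rintro ⟨a, ℓ⟩ ho ⟨a', ℓ'⟩ ho' heq
    simp only [coe_filter, Set.mem_ofPred_eq] at ho ho'
    have ha : a = a' := Nat.succ_injective (congrFun heq none)
    refine Prod.ext ha (funext fun v => ?_)
    by_cases hv : v ∈ τ
    · exact congrFun (ho.2.trans ho'.2.symm) ⟨v, hv⟩
    · exact congrFun heq (some ⟨v, mem_compl.2 hv⟩)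

theorem card_encounters_le_sum (hp : ∀ v, v ∈ p) (W : Finset (Fin n → Option A)) :
    #{w ∈ W | Encounters (List.ofFn w) p} ≤
      ∑ o ∈ occurrences p n, #{w ∈ W | EncountersAt p o.1 o.2 w} := by
  classical
  refine (card_le_card fun w hw => ?_).trans card_biUnion_le
  obtain ⟨hwW, hw⟩ := mem_filter.1 hw
  obtain ⟨a, ℓ, hℓ, h, hconst⟩ := hw.exists_encountersAt
  exact mem_biUnion.2 ⟨(a, ℓ), (mem_occurrences hp).2 ⟨hℓ, length_labels p ℓ ▸ h⟩,
    mem_filter.2 ⟨hwW, h, hconst⟩⟩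

variable [Fintype A] [Nonempty A] {h : ℕ} {τ : Finset V}

theorem sum_count_mul_le_of_mem_occurrences (hp : ∀ v, v ∈ p) {a : ℕ} {ℓ : V → ℕ}
    (ho : (a, ℓ) ∈ occurrences p n) : ∑ v ∈ τ, p.count v * ℓ v ≤ n :=
  (sum_le_univ_sum_of_nonneg fun _ => Nat.zero_le _).trans
    ((Nat.le_add_left _ a).trans ((mem_occurrences hp).1 ho).2)

theorem card_encountersAt_le (hp : ∀ v, v ∈ p) (hn : h ≤ n) (hτ : τ.Nonempty) {a : ℕ} {ℓ : V → ℕ}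
    (ho : (a, ℓ) ∈ occurrences p n) :
    (#{w ∈ wordsWithHoles (Fin n) A h | EncountersAt p a ℓ w} : ℝ) ≤
      #(wordsWithHoles (Fin n) A h) * n *
        (∏ v ∈ τ, constProb (Fintype.card A) ((h : ℝ) / n) (p.count v) ^ ℓ v) /
          (n + 1 - (∑ v ∈ τ, p.count v * ℓ v : ℕ)) := by
  obtain ⟨hℓ, hle⟩ := (mem_occurrences hp).1 ho
  have hL : 0 < ∑ v ∈ τ, p.count v * ℓ v :=
    sum_pos (fun v _ => (hℓ v).trans (le_count_mul_of_mem hp v _)) hτ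
  refine (le_div_iff₀ ?_).2 (card_encountersAt_mul_le hn (length_labels p ℓ ▸ hle) hL)
  rw [← Nat.cast_add_one, sub_pos, Nat.cast_lt, Nat.lt_succ_iff]
  exact sum_count_mul_le_of_mem_occurrences hp ho

theorem sum_card_encountersAt_restrict_eq_le (hp : ∀ v, v ∈ p) (hn : h ≤ n) (hτ : τ.Nonempty)
    (l : τ → ℕ) :
    ∑ o ∈ occurrences p n with τ.restrict o.2 = l,
        (#{w ∈ wordsWithHoles (Fin n) A h | EncountersAt p o.1 o.2 w} : ℝ) ≤
      #(wordsWithHoles (Fin n) A h) * ((n : ℝ) ^ (#τᶜ + 1) / (#τᶜ + 1).factorial *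
        ∏ v : τ, constProb (Fintype.card A) ((h : ℝ) / n) (p.count v.1) ^ l v) := by
  set fiber := {o ∈ occurrences p n | τ.restrict o.2 = l}
  set W : ℝ := (#(wordsWithHoles (Fin n) A h) : ℝ)
  set L := ∑ v : τ, p.count v.1 * l v
  set B := ∏ v : τ, constProb (Fintype.card A) ((h : ℝ) / n) (p.count v.1) ^ l v
  have hB : 0 ≤ B := prod_nonneg fun v _ => pow_nonneg (constProb_nonneg (by positivity)
    (div_le_one_of_le₀ (by exact_mod_cast hn) (by positivity)) _ _) _
  have hencounters : ∀ o ∈ fiber, L ≤ n ∧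
      (#{w ∈ wordsWithHoles (Fin n) A h | EncountersAt p o.1 o.2 w} : ℝ) ≤
        W * n * B / (n + 1 - L) := by
    rintro ⟨a, ℓ⟩ hfiber
    obtain ⟨ho, hl⟩ := mem_filter.1 hfiber
    have hL : ∑ v ∈ τ, p.count v * ℓ v = L := by
      simp only [L, ← hl, restrict, sum_coe_sort τ fun v => p.count v * ℓ v]
    refine ⟨hL ▸ sum_count_mul_le_of_mem_occurrences hp ho,
      (card_encountersAt_le hp hn hτ ho).trans_eq ?_⟩
    rw [hL, ← prod_coe_sort τ]
    simp only [W, B, ← hl, restrict]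
  rcases fiber.eq_empty_or_nonempty with hempty | ⟨o, ho⟩
  · rw [hempty, sum_empty]
    positivity
  have hLn := (hencounters o ho).1
  have hM : ((n + 1 - L : ℕ) : ℝ) = n + 1 - L := by push_cast [hLn.trans n.le_succ]; rfl
  have hM0 : (0 : ℝ) < n + 1 - L := by rw [← hM, Nat.cast_pos]; omega
  have hcard : (#fiber : ℝ) ≤ n ^ #τᶜ * (n + 1 - L) / (#τᶜ + 1).factorial := by
    rw [← hM, le_div_iff₀ (by positivity)]
    exact_mod_cast (Nat.mul_le_mul_right _ (card_occurrences_restrict_eq_le hp τ l)).trans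
      (choose_succ_mul_factorial_le (Nat.sub_le _ _) _)
  calc ∑ o ∈ fiber, (#{w ∈ wordsWithHoles (Fin n) A h | EncountersAt p o.1 o.2 w} : ℝ)
    _ ≤ #fiber • (W * n * B / (n + 1 - L)) :=
      sum_le_card_nsmul _ _ _ fun o ho => (hencounters o ho).2
    _ ≤ n ^ #τᶜ * (n + 1 - L) / (#τᶜ + 1).factorial * (W * n * B / (n + 1 - L)) := by
      rw [nsmul_eq_mul]
      gcongr
    _ = W * ((n : ℝ) ^ (#τᶜ + 1) / (#τᶜ + 1).factorial * B) := by
      field_simp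
      ring

theorem card_encounters_le (hp : ∀ v, v ∈ p) (hn : h ≤ n) (hτ : τ.Nonempty) :
    (#{w ∈ wordsWithHoles (Fin n) A h | Encounters (List.ofFn w) p} : ℝ) ≤
      #(wordsWithHoles (Fin n) A h) * ((n : ℝ) ^ (#τᶜ + 1) / (#τᶜ + 1).factorial *
        ∏ v ∈ τ, ∑ l ∈ Icc 1 n, constProb (Fintype.card A) ((h : ℝ) / n) (p.count v) ^ l) := by
  have hmaps : ∀ o ∈ occurrences p n, τ.restrict o.2 ∈ Fintype.piFinset fun _ : τ => Icc 1 n := by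
    intro o ho
    simp only [occurrences, mem_filter, mem_product, Fintype.mem_piFinset] at ho
    exact Fintype.mem_piFinset.2 fun v => ho.1.2 v
  rw [← prod_coe_sort τ, prod_univ_sum, mul_sum, mul_sum]
  calc (#{w ∈ wordsWithHoles (Fin n) A h | Encounters (List.ofFn w) p} : ℝ)
    _ ≤ ∑ o ∈ occurrences p n,
        (#{w ∈ wordsWithHoles (Fin n) A h | EncountersAt p o.1 o.2 w} : ℝ) := by
      exact_mod_cast card_encounters_le_sum hp _
    _ = ∑ l ∈ Fintype.piFinset fun _ : τ => Icc 1 n,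
        ∑ o ∈ occurrences p n with τ.restrict o.2 = l,
          (#{w ∈ wordsWithHoles (Fin n) A h | EncountersAt p o.1 o.2 w} : ℝ) :=
      (sum_fiberwise_of_maps_to hmaps _).symm
    _ ≤ _ := sum_le_sum fun l _ => sum_card_encountersAt_restrict_eq_le hp hn hτ l

end Occurrences

section Map

variable {A U V : Type*}

theorem Encounters.length_le {w : PartialWord A} {p : List V} (hw : w.Encounters p) :
    p.length ≤ w.length := by
  obtain ⟨φ, hφ, f, hf, hcompat⟩ := hw
  calc p.length
    _ = (p.map fun _ => 1).sum := by simp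
    _ ≤ (p.map fun v => (φ v).length).sum :=
      List.sum_le_sum fun v _ => List.length_pos_iff.2 (hφ v)
    _ = f.length := by rw [hcompat.length_eq, List.length_map, List.length_flatMap]
    _ ≤ w.length := hf.length_le

theorem Encounters.of_map {w : PartialWord A} {p : List U} {f : U → V}
    (hw : w.Encounters (p.map f)) : w.Encounters p := by
  obtain ⟨φ, hφ, u, hu, hcompat⟩ := hw
  rw [List.flatMap_map] at hcompat
  exact ⟨fun v => φ (f v), fun v => hφ (f v), u, hu, hcompat⟩

theorem avoidThreshold_map [DecidableEq U] [DecidableEq V] (m : ℕ) (d : ℚ) (p : List U)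
    (f : U ↪ V) : avoidThreshold m d (p.map f) = avoidThreshold m d p := by
  have htoFinset : (p.map f).toFinset = p.toFinset.map f := by
    ext v
    simp
  simp only [avoidThreshold, numSingle, htoFinset, filter_map, card_map, prod_map,
    Function.comp_def, List.count_map_of_injective _ _ f.injective]

end Map

section Avoidance

theorem countP_ofFn {A : Type*} {n : ℕ} (P : A → Bool) (w : Fin n → A) :
    (List.ofFn w).countP P = #{t | P (w t)} := by
  calc (List.ofFn w).countP P
    _ = Multiset.countP (P · = true) (univ.val.map w) := by simp [Fin.univ_val_map]
    _ = #{t | P (w t)} := Multiset.countP_map _ _ _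

theorem holeDensity_ofFn {A : Type*} [Fintype A] {n h : ℕ} {w : Fin n → Option A}
    (hw : w ∈ wordsWithHoles (Fin n) A h) : holeDensity (List.ofFn w) = (h : ℚ) / n := by
  simp only [holeDensity, countP_ofFn, List.length_ofFn, Option.isNone_iff_eq_none,
    mem_wordsWithHoles.1 hw]

theorem wordsWithHoles_nonempty {A : Type*} [Fintype A] [Nonempty A] {n h : ℕ} (hn : h ≤ n) :
    (wordsWithHoles (Fin n) A h).Nonempty := by
  rw [← card_pos, card_wordsWithHoles, Fintype.card_fin]
  exact Nat.mul_pos (Nat.pow_pos Fintype.card_pos) (Nat.choose_pos hn)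

theorem sum_Icc_one_pow_le {x : ℝ} (hx0 : 0 < x) (hx1 : x < 1) (n : ℕ) :
    ∑ l ∈ Icc 1 n, x ^ l ≤ (x⁻¹ - 1)⁻¹ := by
  have : (x⁻¹ - 1)⁻¹ = x ^ 1 / (1 - x) := by
    have : 1 - x ≠ 0 := by linarith
    field_simp
  rw [this, ← Ico_add_one_right_eq_Icc]
  exact geom_sum_Ico_le_of_lt_one hx0.le hx1

theorem prod_sum_constProb_pow_le {A V : Type*} [Fintype A] [Nonempty A] {τ : Finset V}
    {k : V → ℕ} {d : ℝ} (hd0 : 0 < d) (hd1 : d ≤ 1)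
    (hpos : 0 < ∏ v ∈ τ, ((constProb (Fintype.card A) d (k v))⁻¹ - 1)) (n : ℕ) :
    ∏ v ∈ τ, ∑ l ∈ Icc 1 n, constProb (Fintype.card A) d (k v) ^ l ≤
      (∏ v ∈ τ, ((constProb (Fintype.card A) d (k v))⁻¹ - 1))⁻¹ := by
  have hc0 (v) : 0 < constProb (Fintype.card A) d (k v) := constProb_pos hd0 hd1 _ _
  rw [← prod_inv_distrib]
  refine prod_le_prod (fun v _ => sum_nonneg fun l _ => (pow_pos (hc0 v) l).le) fun v hv => ?_
  refine sum_Icc_one_pow_le (hc0 v) ((constProb_card_le_one hd0.le hd1 _).lt_of_ne fun h1 => ?_) n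
  exact prod_ne_zero_iff.1 hpos.ne' v hv (by rw [h1, inv_one, sub_self])

variable {A V : Type*} [Fintype A] [Nonempty A] [Fintype V] [DecidableEq V] {p : List V} {n h : ℕ}

theorem exists_not_encounters_of_count_eq_one (hcount : ∀ v, p.count v = 1) (h0 : 0 < h)
    (hn : h < n) (hlt : n ^ (Fintype.card V + 1) < (Fintype.card V + 1).factorial) :
    ∃ w ∈ wordsWithHoles (Fin n) A h, ¬ Encounters (List.ofFn w) p := by
  obtain ⟨w, hw⟩ := wordsWithHoles_nonempty (A := A) hn.le
  refine ⟨w, hw, fun hwp => hlt.not_ge (factorial_succ_le_pow ?_ (by omega))⟩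
  have hV : univ ⊆ p.toFinset := fun v _ =>
    List.mem_toFinset.2 (List.count_pos_iff.1 (by rw [hcount]; exact one_pos))
  exact (card_le_card hV).trans (p.toFinset_card_le.trans
    (hwp.length_le.trans_eq List.length_ofFn))

theorem exists_not_encounters_of_lt (hp : ∀ v, v ∈ p) (h0 : 0 < h) (hn : h ≤ n)
    {τ : Finset V} (hτ : τ.Nonempty)
    (hlt : (n : ℝ) ^ (#τᶜ + 1) < (#τᶜ + 1).factorial *
      ∏ v ∈ τ, ((constProb (Fintype.card A) ((h : ℝ) / n) (p.count v))⁻¹ - 1)) :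
    ∃ w ∈ wordsWithHoles (Fin n) A h, ¬ Encounters (List.ofFn w) p := by
  have hn0 : (0 : ℝ) < n := Nat.cast_pos.2 (h0.trans_le hn)
  have hpos : 0 < ∏ v ∈ τ, ((constProb (Fintype.card A) ((h : ℝ) / n) (p.count v))⁻¹ - 1) :=
    pos_of_mul_pos_right ((pow_pos hn0 _).trans hlt) (Nat.cast_nonneg _)
  have hseries := prod_sum_constProb_pow_le (by positivity)
    (div_le_one_of_le₀ (Nat.cast_le.2 hn) hn0.le) hpos n
  by_contra! hall
  have hW : (0 : ℝ) < #(wordsWithHoles (Fin n) A h) :=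
    Nat.cast_pos.2 (wordsWithHoles_nonempty hn).card_pos
  have hunion := card_encounters_le (A := A) hp hn hτ
  rw [filter_true_of_mem hall, le_mul_iff_one_le_right hW] at hunion
  refine hunion.not_gt ((mul_le_mul_of_nonneg_left hseries (by positivity)).trans_lt ?_)
  rwa [← div_eq_mul_inv, div_div, div_lt_one (by positivity)]

end Avoidance

section Threshold

variable {V : Type*} [DecidableEq V] {m : ℕ} {d : ℚ} {p : List V} {n : ℕ}

theorem pow_lt_of_lt_avoidThreshold (hm : m ≠ 0) (hd0 : 0 < d) (hd1 : d ≤ 1)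
    (hlt : (n : ℝ) < avoidThreshold m d p) :
    (n : ℝ) ^ (numSingle p + 1) < (numSingle p + 1).factorial *
      ∏ v ∈ p.toFinset with 2 ≤ p.count v, ((constProb m d (p.count v))⁻¹ - 1) := by
  have : NeZero m := ⟨hm⟩
  have hd0' : (0 : ℝ) < d := Rat.cast_pos.2 hd0
  have hd1' : (d : ℝ) ≤ 1 := by exact_mod_cast hd1
  have hnonneg (k : ℕ) : 0 ≤ (constProb m d k)⁻¹ - 1 := by
    have := constProb_card_le_one (A := Fin m) hd0'.le hd1' k
    rw [Fintype.card_fin] at this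
    exact sub_nonneg.2 ((one_le_inv₀ (constProb_pos hd0' hd1' m k)).2 this)
  have hprod : ∏ v ∈ p.toFinset with 2 ≤ p.count v,
      ((m : ℝ) ^ (p.count v - 1) / patternQ m d (p.count v) - 1) =
      ∏ v ∈ p.toFinset with 2 ≤ p.count v, ((constProb m d (p.count v))⁻¹ - 1) :=
    prod_congr rfl fun v hv => by
      have := (mem_filter.1 hv).2
      rw [pow_div_patternQ_eq_inv_constProb hm d (by omega)]
  rw [avoidThreshold, hprod, one_div, ← Nat.cast_succ] at hlt
  have := pow_lt_pow_left₀ hlt n.cast_nonneg (numSingle p).succ_ne_zero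
  rwa [Real.rpow_inv_natCast_pow (mul_nonneg (Nat.cast_nonneg _)
    (prod_nonneg fun v _ => hnonneg _)) (numSingle p).succ_ne_zero] at this

theorem exists_not_encounters_of_lt_avoidThreshold {h : ℕ} (hp : ∀ v, v ∈ p)
    (hm : m ≠ 0) (h0 : 0 < h) (hn : h < n) (hd : (h : ℚ) / n = d)
    (hlt : (n : ℝ) < avoidThreshold m d p) :
    ∃ w ∈ wordsWithHoles (Fin n) (Fin m) h, ¬ Encounters (List.ofFn w) p := by
  have : NeZero m := ⟨hm⟩
  let _ : Fintype V := ⟨p.toFinset, fun v => List.mem_toFinset.2 (hp v)⟩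
  have hpow := pow_lt_of_lt_avoidThreshold hm
    (hd ▸ div_pos (Nat.cast_pos.2 h0) (Nat.cast_pos.2 (h0.trans hn)))
    (hd ▸ div_le_one_of_le₀ (Nat.cast_le.2 hn.le) n.cast_nonneg) hlt
  have hsupport : p.toFinset = univ := rfl
  rw [numSingle, hsupport, ← hd] at hpow
  push_cast at hpow
  set τ : Finset V := {v | 2 ≤ p.count v}
  have hcompl : ({v | p.count v = 1} : Finset V) = τᶜ := by
    ext v
    have := List.count_pos_iff.2 (hp v)
    simp only [τ, mem_compl, mem_filter_univ]
    omega
  rw [hcompl] at hpow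
  rcases τ.eq_empty_or_nonempty with hτ | hτ
  · rw [hτ, prod_empty, mul_one, compl_empty, card_univ] at hpow
    refine exists_not_encounters_of_count_eq_one (fun v => ?_) h0 hn (by exact_mod_cast hpow)
    rw [← mem_filter_univ (p := fun v => p.count v = 1), hcompl, hτ, compl_empty]
    exact mem_univ v
  · exact exists_not_encounters_of_lt hp h0 hn.le hτ (by rwa [Fintype.card_fin])

theorem exists_avoids_of_lt_avoidThreshold (hm : m ≠ 0) (hd0 : 0 < d) (hd1 : d < 1) (hn : 0 < n)
    (hdn : ∃ h : ℕ, (h : ℚ) = d * n) (hlt : (n : ℝ) < avoidThreshold m d p) :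
    ∃ w : PartialWord (Fin m), w.length = n ∧ w.holeDensity = d ∧ w.Avoids p := by
  obtain ⟨h, hh⟩ := hdn
  have hn' : (0 : ℚ) < n := Nat.cast_pos.2 hn
  have h0 : 0 < h := Nat.cast_pos.1 (hh ▸ mul_pos hd0 hn')
  have hhn : h < n := Nat.cast_lt.1 (hh ▸ mul_lt_of_lt_one_left hn' hd1)
  have hd : (h : ℚ) / n = d := (div_eq_iff hn'.ne').2 hh
  rw [← p.attach_map_subtype_val] at hlt ⊢
  obtain ⟨w, hw, hwp⟩ := exists_not_encounters_of_lt_avoidThreshold (p.mem_attach ·) hm h0 hhn hd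
    ((avoidThreshold_map m d p.attach (.subtype (· ∈ p))) ▸ hlt)
  exact ⟨List.ofFn w, List.length_ofFn, (holeDensity_ofFn hw).trans hd, mt .of_map hwp⟩

theorem avoidThreshold_le_partialRamseyLength (hm : m ≠ 0) (hd0 : 0 < d) (hd1 : d < 1)
    (p : List V) :
    ENNReal.ofReal (avoidThreshold m d p) ≤ (partialRamseyLength d m p : ENNReal) := by
  rw [partialRamseyLength]
  set S := {N : ℕ∞ | ∃ n : ℕ, N = n ∧
    (∃ w : PartialWord (Fin m), w.length = n ∧ w.holeDensity = d) ∧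
    ∀ w : PartialWord (Fin m), w.length = n → w.holeDensity = d → w.Encounters p}
  rcases S.eq_empty_or_nonempty with hempty | hne
  · rw [hempty, sInf_empty, ENat.toENNReal_top]
    exact le_top
  obtain ⟨n, hN, ⟨w, rfl, rfl⟩, hall⟩ := csInf_mem hne
  rw [hN, ENat.toENNReal_coe, ENNReal.ofReal_le_natCast]
  by_contra! hlt
  have hn : 0 < w.length := by
    refine Nat.pos_of_ne_zero fun hw => hd0.ne' ?_
    rw [holeDensity, hw, Nat.cast_zero, div_zero]
  obtain ⟨w', hlength, hdensity, havoids⟩ := exists_avoids_of_lt_avoidThreshold hm hd0 hd1 hn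
    ⟨_, (div_mul_cancel₀ _ (Nat.cast_ne_zero.2 hn.ne')).symm⟩ hlt
  exact havoids (hall w' hlength hdensity)

end Threshold

section Zimin

theorem toFinset_zimin (i : ℕ) : (zimin i).toFinset = Icc 1 i := by
  induction i with
  | zero => rfl
  | succ i ih =>
    ext v
    simp only [zimin, List.toFinset_append, ih, mem_union, List.mem_toFinset, List.mem_singleton,
      mem_Icc]
    omega

theorem count_zimin {i j : ℕ} (hj : j < i) : (zimin i).count (i - j) = 2 ^ j := by
  induction i generalizing j with
  | zero => omega
  | succ i ih =>
    rw [zimin, List.count_append, List.count_append]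
    rcases j with _ | j
    · have : i + 1 ∉ zimin i := fun h => by
        have := mem_Icc.1 (toFinset_zimin i ▸ List.mem_toFinset.2 h)
        omega
      simp [List.count_eq_zero.2 this]
    · rw [Nat.add_sub_add_right, ih (by omega), List.count_singleton, if_neg (by simp; omega)]
      ring

theorem numSingle_zimin {i : ℕ} (hi : 1 ≤ i) : numSingle (zimin i) = 1 := by
  rw [numSingle, card_eq_one]
  refine ⟨i, ext fun v => ?_⟩
  rw [toFinset_zimin, mem_filter, mem_Icc, mem_singleton]
  refine ⟨fun ⟨hv, hcount⟩ => ?_, ?_⟩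
  · rw [← Nat.sub_sub_self hv.2, count_zimin (by omega)] at hcount
    have := (Nat.pow_eq_one.1 hcount).resolve_left (by norm_num)
    omega
  · rintro rfl
    exact ⟨by omega, count_zimin (j := 0) hi⟩

theorem filter_two_le_count_zimin (i : ℕ) :
    {v ∈ (zimin i).toFinset | 2 ≤ (zimin i).count v} = (Icc 1 (i - 1)).image (i - ·) := by
  ext v
  rw [toFinset_zimin, mem_filter, mem_Icc, mem_image]
  constructor
  · rintro ⟨hv, hcount⟩
    refine ⟨i - v, mem_Icc.2 ⟨?_, by omega⟩, Nat.sub_sub_self hv.2⟩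
    rwa [← Nat.sub_sub_self hv.2, count_zimin (by omega), Nat.succ_le_iff,
      Nat.one_lt_two_pow_iff, ← Nat.one_le_iff_ne_zero] at hcount
  · rintro ⟨j, hj, rfl⟩
    have := mem_Icc.1 hj
    exact ⟨by omega, count_zimin (show j < i by omega) ▸ Nat.le_self_pow (by omega) 2⟩

theorem avoidThreshold_zimin (m : ℕ) (d : ℚ) {i : ℕ} (hi : 1 ≤ i) :
    avoidThreshold m d (zimin i) = √(2 * ∏ j ∈ Icc 1 (i - 1),
      ((m : ℝ) ^ (2 ^ j - 1) / patternQ m d (2 ^ j) - 1)) := by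
  have hinj : Set.InjOn (i - ·) (Icc 1 (i - 1) : Finset ℕ) := fun j hj j' hj' h => by
    simp only [coe_Icc, Set.mem_Icc] at hj hj' h
    omega
  have hcount : ∀ j ∈ Icc 1 (i - 1), (zimin i).count (i - j) = 2 ^ j := fun j hj =>
    count_zimin (by have := mem_Icc.1 hj; omega)
  rw [avoidThreshold, filter_two_le_count_zimin, prod_image hinj, numSingle_zimin hi,
    Real.sqrt_eq_rpow, prod_congr rfl fun j hj => by rw [hcount j hj]]
  norm_num

end Zimin

end PartialWord

theorem mainTheorem9 {V : Type*} [DecidableEq V] (m : ℕ) (hm : 1 ≤ m)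
    (d : ℚ) (hd0 : 0 < d) (hd1 : d < 1) :
    (∀ (p : List V) (n : ℕ), 0 < n → (∃ h : ℕ, (h : ℚ) = d * n) →
      (n : ℝ) < avoidThreshold m d p →
      ∃ w : PartialWord (Fin m), w.length = n ∧ w.holeDensity = d ∧ w.Avoids p) ∧
    (∀ i : ℕ, 1 ≤ i →
      ENNReal.ofReal (Real.sqrt (2 * ∏ j ∈ Finset.Icc 1 (i - 1),
        ((m : ℝ) ^ (2 ^ j - 1) / patternQ m d (2 ^ j) - 1))) ≤
      (partialRamseyLength d m (zimin i) : ENNReal)) := by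
  have hm0 : m ≠ 0 := Nat.one_le_iff_ne_zero.1 hm
  refine ⟨fun p n hn hdn hlt =>
    PartialWord.exists_avoids_of_lt_avoidThreshold hm0 hd0 hd1 hn hdn hlt, fun i hi => ?_⟩
  rw [← PartialWord.avoidThreshold_zimin m d hi]
  exact PartialWord.avoidThreshold_le_partialRamseyLength hm0 hd0 hd1 (zimin i)
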